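/- Let $n\ge 0$ and let $\mathcal G$ be a directed graph without loops on $\mathcal V=\{1,\dots,n\}$. Let $\mathcal M_1,\dots,\mathcal M_S\subseteq\mathcal V$ with $\bigcup_s\mathcal M_s=\mathcal V$. Consider the multi-sender single-uniprior index-coding instance with one-bit messages $x_1,\dots,x_n$, in which sender $s$ knows $\{x_i:i\in\mathcal M_s\}$, and receiver $i\in\{1,\dots,n\}$ knows $x_i$ and requests all $x_j$ with $(j\to i)$ an arc of $\mathcal G$. Let $\mathcal U$ be the message graph on $\mathcal V$: distinct $i,j$ are joined by an edge iff $i,j\in\mathcal M_s$ for some $s$. An index code has an encoder for each sender $s$, from the messages it knows to $\ell_s$ bits, and a decoder for each receiver that, for every value of the messages, recovers the requested messages from all sub-codewords and the receiver's own message; $\tilde\ell^*$ is the minimum of $\sum_s\ell_s$ over all index codes. Definitions. A leaf vertex has no outgoing arc; $V_{\rm out}(\cdot)$ is the number of non-leaf vertices; $u$ is a predecessor of $v$ if there is a directed path from $u$ to $v$; a directed graph is grounded if every vertex is a leaf vertex or a predecessor of one. A leaf SCC is a strongly connected component with at least two vertices and no arc leaving it. A leaf SCC with vertex set $V$ is *message-connected*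 if any two of its vertices are joined by a path in $\mathcal U$ inside $V$; *message-disconnected* if two of its vertices are joined by no path in $\mathcal U$; and *semi-message-connected* otherwise. A semi-message-connected leaf SCC is *degenerated* if there are a nonempty $A\subsetneq V$ and a $B\subseteq\mathcal V\setminus V$ such that no edge of $\mathcal U$ joins $A$ to $V\setminus A$, at most one vertex of $B$ is non-leaf, and every vertex outside $A$ that is joined to $A$ by an edge of $\mathcal U$ is in $B$ or is a predecessor of a vertex of $B$; otherwise it is *non-degenerated*. Operations. *Pruning* a leaf SCC: remove all outgoing arcs of one (arbitrary) vertex of it. *Appending* a message-disconnected leaf SCC: add a new (dummy) vertex, isolated in $\mathcal U$, and an arc to it from one vertex of the SCC. *Appending* a degenerated leaf SCC: choose $A,B$ as above and add an arc from a vertex of $A$ to the non-leaf vertex of $B$ if there is one, and to any vertex of $B$ otherwise. Combined appending–pruning algorithm on the input $(\mathcal G,\mathcal U)$ (all choices and orders are arbitrary). *Clean-up*: while there is a message-disconnected or degenerated leaf SCC, append each message-disconnected leaf SCC, and then, while there is a degenerated leaf SCC, append one. *Initialization*: prune each message-connected leaf SCC; then perform the clean-up. *Iteration*: while there is a leaf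 SCC, prune one message-connected leaf SCC if there is one, and one non-degenerated leaf SCC otherwise; then perform the clean-up. Theorem. Every run of the algorithm terminates after finitely many steps, and the resulting information-flow graph $\mathcal G^\dagger$ is grounded and satisfies $$\tilde\ell^*\ \ge\ V_{\rm out}(\mathcal G^\dagger)\ =\ V_{\rm out}(\mathcal G)-\#(\text{pruning steps in Initialization})-\#(\text{pruning steps in all Iterations})\ =\ V_{\rm out}(\mathcal G)-(N_{\rm conn}+T),$$ where $N_{\rm conn}$ is the number of message-connected leaf SCCs in $(\mathcal G,\mathcal U)$ and $T$ is the number of times Iteration is repeated in the run. -/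

import Mathlib

/-- An index-coding instance with `m` one-bit messages, `n` receivers and `s` senders.
Sender `t` knows the messages in `sends t`; receiver `r` knows the messages in `knows r` a priori
and requests the messages in `wants r`. -/
structure IndexCodingInstance (m n s : ℕ) where
  sends : Fin s → Finset (Fin m)
  knows : Fin n → Finset (Fin m)
  wants : Fin n → Finset (Fin m)

/-- A (zero-error) multi-sender index code: sender `t` maps the messages it knows to a sub-codeword
of `len t` bits, and every receiver recovers its requested messages from all the sub-codewords and
its own side information, for every realisation `x` of the messages. -/
structure IndexCode {m n s : ℕ} (I : IndexCodingInstance m n s) where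
  len : Fin s → ℕ
  encode : (t : Fin s) → ({i // i ∈ I.sends t} → Bool) → (Fin (len t) → Bool)
  decode : (r : Fin n) → ((t : Fin s) → Fin (len t) → Bool) →
    ({i // i ∈ I.knows r} → Bool) → ({i // i ∈ I.wants r} → Bool)
  correct : ∀ (x : Fin m → Bool) (r : Fin n) (i : {i // i ∈ I.wants r}),
    decode r (fun t => encode t (fun j => x j.1)) (fun j => x j.1) i = x i.1

/-- The index codelength: the total number of bits transmitted by all the senders. -/
def IndexCode.codelength {m n s : ℕ} {I : IndexCodingInstance m n s} (c : IndexCode I) : ℕ :=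
  ∑ t, c.len t

/-- The optimal (minimum) index codelength. -/
noncomputable def IndexCodingInstance.optimalCodelength {m n s : ℕ}
    (I : IndexCodingInstance m n s) : ℕ :=
  sInf {l : ℕ | ∃ c : IndexCode I, c.codelength = l}

open Classical in
/-- The single-uniprior instance with information-flow graph `G` and sender setting `M`: receiver
`i` knows exactly the message `x i`, and requests `x j` for every arc `j → i` of `G`. -/
noncomputable def singleUniprior {n s : ℕ} (G : Digraph (Fin n)) (M : Fin s → Finset (Fin n)) :
    IndexCodingInstance n n s where
  sends := M
  knows i := {i}
  wants i := Finset.univ.filter fun j => G.Adj j i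

/-- The message graph of a sender setting: distinct `i`, `j` are joined by an edge if and only if
some sender knows both of the messages `x i` and `x j`. -/
def messageGraph {n s : ℕ} (M : Fin s → Finset (Fin n)) : SimpleGraph (Fin n) where
  Adj i j := i ≠ j ∧ ∃ t, i ∈ M t ∧ j ∈ M t
  symm := ⟨fun _ _ h => ⟨h.1.symm, h.2.imp fun _ ht => ⟨ht.2, ht.1⟩⟩⟩
  loopless := ⟨fun _ h => h.1 rfl⟩

/-- An information-flow graph (`arcs`) together with a message graph (`edges`) on the common vertex
set `{0, …, order - 1}`; the next dummy vertex to be added is the vertex `order`. -/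
structure GraphPair where
  order : ℕ
  arcs : Digraph ℕ
  edges : SimpleGraph ℕ

namespace GraphPair

/-- The pair `(G, U)` with its vertices `Fin n` read as the numbers `0, …, n - 1`. -/
def ofGraphs {n : ℕ} (G : Digraph (Fin n)) (U : SimpleGraph (Fin n)) : GraphPair where
  order := n
  arcs := ⟨fun a b => ∃ i j : Fin n, G.Adj i j ∧ (i : ℕ) = a ∧ (j : ℕ) = b⟩
  edges := U.map Fin.valEmbedding

/-- A leaf vertex has no outgoing arc. -/
def IsLeaf (P : GraphPair) (v : ℕ) : Prop := ∀ w, ¬ P.arcs.Adj v w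

/-- `u` is a predecessor of `v`: there is a directed path from `u` to `v`. -/
def IsPredecessor (P : GraphPair) (u v : ℕ) : Prop := Relation.TransGen P.arcs.Adj u v

/-- The number of non-leaf vertices of the information-flow graph. -/
noncomputable def vOut (P : GraphPair) : ℕ := {v : ℕ | v < P.order ∧ ¬ P.IsLeaf v}.ncard

/-- Every vertex is a leaf vertex or a predecessor of some leaf vertex. -/
def IsGrounded (P : GraphPair) : Prop :=
  ∀ v < P.order, P.IsLeaf v ∨ ∃ w < P.order, P.IsLeaf w ∧ P.IsPredecessor v w

/-- Any two vertices of `V` are joined, in both directions, by directed paths that stay in `V`. -/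
def IsStronglyConnectedSet (P : GraphPair) (V : Finset ℕ) : Prop :=
  V ⊆ Finset.range P.order ∧ ∀ i ∈ V, ∀ j ∈ V,
    Relation.ReflTransGen (fun a b => P.arcs.Adj a b ∧ a ∈ V ∧ b ∈ V) i j

/-- `V` is the vertex set of a leaf SCC: a strongly connected component with at least two vertices
and with no arc from a vertex in it to a vertex outside it. -/
def IsLeafSCC (P : GraphPair) (V : Finset ℕ) : Prop :=
  Maximal P.IsStronglyConnectedSet V ∧ 2 ≤ V.card ∧ ∀ i ∈ V, ∀ j, P.arcs.Adj i j → j ∈ V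

/-- A leaf SCC any two vertices of which are joined by a path of edges inside the SCC. -/
def IsMessageConnected (P : GraphPair) (V : Finset ℕ) : Prop :=
  P.IsLeafSCC V ∧ (P.edges.induce (V : Set ℕ)).Preconnected

/-- A leaf SCC with two vertices that are joined by no path of edges at all. -/
def IsMessageDisconnected (P : GraphPair) (V : Finset ℕ) : Prop :=
  P.IsLeafSCC V ∧ ∃ a ∈ V, ∃ b ∈ V, ¬ P.edges.Reachable a b

/-- A semi-message-connected leaf SCC. -/
def IsSemi (P : GraphPair) (V : Finset ℕ) : Prop :=
  P.IsLeafSCC V ∧ ¬ P.IsMessageConnected V ∧ ¬ P.IsMessageDisconnected V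

/-- A vertex outside `A` is a neighbor of `A` if an edge joins it to some vertex of `A`. -/
def IsNeighbor (P : GraphPair) (A : Finset ℕ) (w : ℕ) : Prop :=
  w ∉ A ∧ ∃ v ∈ A, P.edges.Adj w v

/-- The sets `A` (inside the leaf SCC `V`) and `B` (outside of it) witness that `V` is
degenerated. -/
structure IsWitness (P : GraphPair) (V A B : Finset ℕ) : Prop where
  inside_nonempty : A.Nonempty
  inside : A ⊂ V
  outside : B ⊆ Finset.range P.order \ V
  no_edge : ∀ i ∈ A, ∀ j ∈ V \ A, ¬ P.edges.Adj i j
  nonleaf_unique : ∀ b ∈ B, ∀ b' ∈ B, ¬ P.IsLeaf b → ¬ P.IsLeaf b' → b = b'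
  neighbors : ∀ w, P.IsNeighbor A w → w ∈ B ∨ ∃ b ∈ B, P.IsPredecessor w b

/-- A degenerated leaf SCC. -/
def IsDegenerated (P : GraphPair) (V : Finset ℕ) : Prop :=
  P.IsSemi V ∧ ∃ A B, P.IsWitness V A B

/-- A non-degenerated leaf SCC. -/
def IsNonDegenerated (P : GraphPair) (V : Finset ℕ) : Prop :=
  P.IsSemi V ∧ ¬ P.IsDegenerated V

/-- The number of message-connected leaf SCCs. -/
noncomputable def numMessageConnected (P : GraphPair) : ℕ :=
  {V : Finset ℕ | P.IsMessageConnected V}.ncard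

/-- Remove all outgoing arcs of `v`. -/
def prune (P : GraphPair) (v : ℕ) : GraphPair where
  order := P.order
  arcs := ⟨fun a b => P.arcs.Adj a b ∧ a ≠ v⟩
  edges := P.edges

/-- Add the arc `u → w`. -/
def addArc (P : GraphPair) (u w : ℕ) : GraphPair where
  order := P.order
  arcs := ⟨fun a b => P.arcs.Adj a b ∨ (a = u ∧ b = w)⟩
  edges := P.edges

/-- Add a dummy vertex (isolated in the message graph) and an arc from `v` to it. -/
def addDummy (P : GraphPair) (v : ℕ) : GraphPair where
  order := P.order + 1
  arcs := ⟨fun a b => P.arcs.Adj a b ∨ (a = v ∧ b = P.order)⟩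
  edges := P.edges

/-- `Q` results from pruning the leaf SCC with vertex set `V`. -/
def Prunes (P : GraphPair) (V : Finset ℕ) (Q : GraphPair) : Prop :=
  ∃ v ∈ V, Q = P.prune v

/-- `Q` results from appending the message-disconnected leaf SCC with vertex set `V`. -/
def AppendsDisconnected (P : GraphPair) (V : Finset ℕ) (Q : GraphPair) : Prop :=
  ∃ v ∈ V, Q = P.addDummy v

/-- `Q` results from appending the degenerated leaf SCC with vertex set `V`: for some choice of the
witnessing sets `A` and `B`, an arc is added from some vertex of `A` to the non-leaf vertex of `B`,
or to some vertex of `B` if all of these are leaf vertices. -/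
def AppendsDegenerated (P : GraphPair) (V : Finset ℕ) (Q : GraphPair) : Prop :=
  ∃ A B, P.IsWitness V A B ∧ ∃ u ∈ A, ∃ w ∈ B,
    (¬ P.IsLeaf w ∨ ∀ b ∈ B, P.IsLeaf b) ∧ Q = P.addArc u w

end GraphPair

/-- The list `L` enumerates, in some order and without repetition, the vertex sets satisfying `p`:
the order in which a `foreach` loop treats them. -/
def Enumerates (L : List (Finset ℕ)) (p : Finset ℕ → Prop) : Prop :=
  L.Nodup ∧ ∀ V, V ∈ L ↔ p V

/-- The points of control of the combined appending–pruning algorithm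

```
Initialization:
  foreach message-connected leaf SCC: prune it                       (initPrune)
  while there is a message-disconnected or degenerated leaf SCC:     (cleanTest)
    foreach message-disconnected leaf SCC: append it                 (appendDisc)
    while there is a degenerated leaf SCC: append one                (appendDeg)
Iteration:
  while there is a leaf SCC:                                         (iterTest)
    if there is a message-connected leaf SCC: prune one such
    else: prune one non-degenerated leaf SCC
    while there is a message-disconnected or degenerated leaf SCC:   (cleanTest)
      foreach message-disconnected leaf SCC: append it               (appendDisc)
      while there is a degenerated leaf SCC: append one              (appendDeg)
```

The list carried by a `foreach` loop holds the leaf SCCs that the loop still has to treat.  Both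
occurrences of the cleaning loop are followed by the test of the Iteration loop. -/
inductive Control
  | start
  | initPrune (L : List (Finset ℕ))
  | cleanTest
  | appendDisc (L : List (Finset ℕ))
  | appendDeg
  | iterTest
  | done

/-- A configuration of the algorithm: the point of control, the current pair of graphs, the numbers
of pruning steps made so far in Initialization and in the Iterations, and the number of
Iterations begun so far. -/
structure Config where
  control : Control
  graphs : GraphPair
  initPrunes : ℕ
  iterPrunes : ℕ
  iterations : ℕ

/-- The configuration in which the algorithm starts on the input `P`. -/
def Config.initial (P : GraphPair) : Config := ⟨.start, P, 0, 0, 0⟩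

/-- One step of the (nondeterministic) combined appending–pruning algorithm. -/
inductive Step : Config → Config → Prop
  | enter {P p q k} (L : List (Finset ℕ)) : Enumerates L P.IsMessageConnected →
      Step ⟨.start, P, p, q, k⟩ ⟨.initPrune L, P, p, q, k⟩
  | initPrune {P Q p q k V L} : P.Prunes V Q →
      Step ⟨.initPrune (V :: L), P, p, q, k⟩ ⟨.initPrune L, Q, p + 1, q, k⟩
  | initPruneEnd {P p q k} :
      Step ⟨.initPrune [], P, p, q, k⟩ ⟨.cleanTest, P, p, q, k⟩
  | cleanEnter {P p q k} (L : List (Finset ℕ)) :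
      (∃ V, P.IsMessageDisconnected V ∨ P.IsDegenerated V) →
      Enumerates L P.IsMessageDisconnected →
      Step ⟨.cleanTest, P, p, q, k⟩ ⟨.appendDisc L, P, p, q, k⟩
  | cleanExit {P p q k} :
      (¬ ∃ V, P.IsMessageDisconnected V ∨ P.IsDegenerated V) →
      Step ⟨.cleanTest, P, p, q, k⟩ ⟨.iterTest, P, p, q, k⟩
  | appendDisc {P Q p q k V L} : P.AppendsDisconnected V Q →
      Step ⟨.appendDisc (V :: L), P, p, q, k⟩ ⟨.appendDisc L, Q, p, q, k⟩
  | appendDiscEnd {P p q k} :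
      Step ⟨.appendDisc [], P, p, q, k⟩ ⟨.appendDeg, P, p, q, k⟩
  | appendDeg {P Q p q k} (V : Finset ℕ) : P.IsDegenerated V → P.AppendsDegenerated V Q →
      Step ⟨.appendDeg, P, p, q, k⟩ ⟨.appendDeg, Q, p, q, k⟩
  | appendDegEnd {P p q k} : (¬ ∃ V, P.IsDegenerated V) →
      Step ⟨.appendDeg, P, p, q, k⟩ ⟨.cleanTest, P, p, q, k⟩
  | iterConnected {P Q p q k} (V : Finset ℕ) : P.IsMessageConnected V → P.Prunes V Q →
      Step ⟨.iterTest, P, p, q, k⟩ ⟨.cleanTest, Q, p, q + 1, k + 1⟩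
  | iterNonDegenerated {P Q p q k} (V : Finset ℕ) : (¬ ∃ W, P.IsMessageConnected W) →
      P.IsNonDegenerated V → P.Prunes V Q →
      Step ⟨.iterTest, P, p, q, k⟩ ⟨.cleanTest, Q, p, q + 1, k + 1⟩
  | iterExit {P p q k} : (¬ ∃ V, P.IsLeafSCC V) →
      Step ⟨.iterTest, P, p, q, k⟩ ⟨.done, P, p, q, k⟩

/-- `c` can occur in a run of the algorithm on the input `P`. -/
def Reaches (P : GraphPair) (c : Config) : Prop :=
  Relation.ReflTransGen Step (Config.initial P) c

/-- Every run on the input `P`, whatever choices are made in it, halts after finitely many steps,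
and halts only where the algorithm is done. -/
def AlwaysTerminates (P : GraphPair) : Prop :=
  (¬ ∃ f : ℕ → Config, f 0 = Config.initial P ∧ ∀ i, Step (f i) (f (i + 1))) ∧
    ∀ c, Reaches P c → c.control ≠ .done → ∃ c', Step c c'

/-! The lower bound rests on one invariant, `IsDecodable`: for every index code and every arc a → b
of the current graph, the codeword, x_b and the messages of the leaf vertices determine x_a.
Receiver b gives this for the original arcs. In a grounded graph, walking back along paths that end
in leaves shows that the codeword and the leaf messages determine everything. With the messages
outside the non-leaf vertices fixed, encoding is then injective in the non-leaf messages, so the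
codelength is at least `vOut`.

Pruning deletes arcs and only enlarges the set of leaves, so it keeps the invariant. Appending is
justified by `Determines.of_separated`: some arc j → i of the leaf SCC leaves a set A that no edge
joins to the rest of the SCC, and x_i, being outside A and its neighbors, is no help in decoding
x_j. It can be replaced by the messages of the neighbors of A, and x_j then yields the whole SCC. If
A is a component of the message graph there are no neighbors, and leaves suffice; if A, B witness
degeneration, the neighbors follow from the leaves and the one non-leaf vertex of B.

Each pruning lowers `vOut` by one and appending preserves it, which gives the count: Initialization
prunes the initial message-connected leaf SCCs, which are disjoint, once each, and an Iteration
prunes once. Runs terminate because the lexicographic triple (`vOut`, `numUngrounded`,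
`numUnreachable`) drops at every change of the graphs, with `controlRank` covering the other steps.
At the end there is no leaf SCC, which forces groundedness. -/

/-! ### Messages determined by a code and side information -/

namespace IndexCode

variable {m n s : ℕ} {I : IndexCodingInstance m n s}

/-- The tuple of all sub-codewords, for messages indexed by the natural numbers (only the first `m`
of which matter). -/
def codeword (c : IndexCode I) (x : ℕ → Bool) : (t : Fin s) → Fin (c.len t) → Bool :=
  fun t => c.encode t fun j => x j.1

/-- The codeword and the messages indexed by `S` determine the message `x v`. -/
def Determines (c : IndexCode I) (S : Set ℕ) (v : ℕ) : Prop :=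
  ∀ x y : ℕ → Bool, c.codeword x = c.codeword y → (∀ i ∈ S, x i = y i) → x v = y v

theorem Determines.of_mem {c : IndexCode I} {S : Set ℕ} {v : ℕ} (h : v ∈ S) :
    c.Determines S v := fun _ _ _ hS => hS v h

theorem Determines.trans {c : IndexCode I} {S T : Set ℕ} {v : ℕ}
    (h : c.Determines S v) (hS : ∀ i ∈ S, c.Determines T i) : c.Determines T v :=
  fun x y hc hT => h x y hc fun i hi => hS i hi x y hc hT

theorem Determines.mono {c : IndexCode I} {S T : Set ℕ} {v : ℕ}
    (h : c.Determines S v) (hS : S ⊆ T) : c.Determines T v :=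
  h.trans fun _ hi => .of_mem (hS hi)

open Classical in
/-- If every sender knowing a message of `A` knows no message outside `A ∪ N`, then side
information outside `A ∪ N` is of no use for a message of `A` once the messages of `N` are known. -/
theorem Determines.of_separated {c : IndexCode I} {A N S : Set ℕ} {i j : ℕ}
    (hAN : ∀ t, ∀ a ∈ I.sends t, ∀ b ∈ I.sends t, (a : ℕ) ∈ A → (b : ℕ) ∈ A ∪ N)
    (hj : j ∈ A) (hi : i ∉ A ∪ N) (h : c.Determines (insert i S) j) :
    c.Determines (S ∪ N) j := by
  intro x y hc hS
  -- Zeroing everything outside `A ∪ N` makes the message `i` known for free, and leaves intact each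
  -- sub-codeword whose sender meets `A`.
  let trim : (ℕ → Bool) → ℕ → Bool := fun z k => if k ∈ A ∪ N then z k else false
  have key := h (trim x) (trim y) ?_ ?_
  · simpa [trim, hj] using key
  · funext t
    by_cases ht : ∃ a ∈ I.sends t, (a : ℕ) ∈ A
    · obtain ⟨a, hat, haA⟩ := ht
      have hz : ∀ z, c.codeword (trim z) t = c.codeword z t := fun z => by
        refine congrArg (c.encode t) (funext fun b => ?_)
        exact if_pos (hAN t a hat b.1 b.2 haA)
      rw [hz, hz, hc]
    -- This sender knows nothing in `A`: its messages lie in `N`, where `x` and `y` agree, or have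
    -- been zeroed.
    · refine congrArg (c.encode t) (funext fun b => ?_)
      by_cases hb : (b.1 : ℕ) ∈ A ∪ N
      · have hbN : (b.1 : ℕ) ∈ N := hb.resolve_left fun hA => ht ⟨b.1, b.2, hA⟩
        simpa [trim, hbN] using hS _ (Or.inr hbN)
      · simp only [trim, if_neg hb]
  · rintro k (rfl | hk)
    · simp only [trim, if_neg hi]
    · simp only [trim, hS k (Or.inl hk)]

/-- With all messages outside `K` set to zero, the codeword alone determines the 2^|K| remaining
assignments, and there are only 2^codelength codewords. -/
theorem ncard_le_codelength (c : IndexCode I) {K : Set ℕ} (hK : K.Finite)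
    (h : ∀ v ∈ K, c.Determines Kᶜ v) : K.ncard ≤ c.codelength := by
  classical
  have := hK.fintype
  let extend : (K → Bool) → ℕ → Bool := fun z k => if hk : k ∈ K then z ⟨k, hk⟩ else false
  have hinj : Function.Injective fun z => c.codeword (extend z) := by
    intro z z' hz
    funext k
    have := h k.1 k.2 (extend z) (extend z') hz fun i hi => by
      have hi' : i ∉ K := hi
      simp only [extend, dif_neg hi']
    simpa only [extend, dif_pos k.2] using this
  have hcard := Fintype.card_le_of_injective _ hinj
  simp only [Fintype.card_pi, Fintype.card_bool, Finset.prod_const, Finset.card_univ,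
    Fintype.card_fin, Finset.prod_pow_eq_pow_sum] at hcard
  rw [← Nat.card_coe_set_eq, Nat.card_eq_fintype_card]
  exact (Nat.pow_le_pow_iff_right (by norm_num)).1 hcard

end IndexCode

theorem IndexCodingInstance.le_optimalCodelength {m n s : ℕ} {I : IndexCodingInstance m n s}
    (hne : Nonempty (IndexCode I)) {k : ℕ} (h : ∀ c : IndexCode I, k ≤ c.codelength) :
    k ≤ I.optimalCodelength := by
  obtain ⟨c, hc⟩ := Nat.sInf_mem (s := {l : ℕ | ∃ c : IndexCode I, c.codelength = l})
    ⟨_, hne.some, rfl⟩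
  exact (h c).trans_eq hc

/-- Uncoded transmission: every sender transmits all the messages it knows. -/
theorem IndexCodingInstance.nonempty_indexCode {m n s : ℕ} (I : IndexCodingInstance m n s)
    (h : ∀ i, ∃ t, i ∈ I.sends t) : Nonempty (IndexCode I) := by
  choose t ht using h
  exact ⟨{
    len := fun t => (I.sends t).card
    encode := fun t z k => z ((I.sends t).equivFin.symm k)
    decode := fun _ w _ i => w (t i.1) ((I.sends (t i.1)).equivFin ⟨i.1, ht i.1⟩)
    correct := fun x r i => by simp }⟩

theorem singleUniprior_determines {n s : ℕ} {G : Digraph (Fin n)} {M : Fin s → Finset (Fin n)}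
    (c : IndexCode (singleUniprior G M)) {i j : Fin n} (h : G.Adj j i) :
    c.Determines {(i : ℕ)} j := by
  intro x y hc hS
  have hx := c.correct (fun k => x k) i ⟨j, by simpa [singleUniprior] using h⟩
  have hy := c.correct (fun k => y k) i ⟨j, by simpa [singleUniprior] using h⟩
  have hside : (fun k : {k // k ∈ (singleUniprior G M).knows i} => x k.1) = fun k => y k.1 := by
    funext k
    have hk : k.1 = i := by simpa [singleUniprior] using k.2
    rw [hk]
    exact hS _ rfl
  refine hx.symm.trans (Eq.trans ?_ hy)
  have hc' : (fun t => c.encode t fun j => x j.1) = fun t => c.encode t fun j => y j.1 := hc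
  rw [hc', hside]

/-! ### Leaf SCCs, traps and groundedness -/

namespace GraphPair

/-- The set `V` consists of non-leaf vertices, and no arc leaves it. -/
structure IsTrap (P : GraphPair) (V : Finset ℕ) : Prop where
  not_isLeaf : ∀ v ∈ V, ¬ P.IsLeaf v
  closed : ∀ v ∈ V, ∀ w, P.arcs.Adj v w → w ∈ V

/-- Every arc joins two distinct vertices of the pair. -/
structure IsSimple (P : GraphPair) : Prop where
  bounded : ∀ a b, P.arcs.Adj a b → a < P.order ∧ b < P.order
  loopless : ∀ a, ¬ P.arcs.Adj a a

variable {P : GraphPair} {V W A B : Finset ℕ}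

theorem exists_adj_of_reflTransGen {r : ℕ → ℕ → Prop} {S : Set ℕ} {a b : ℕ}
    (h : Relation.ReflTransGen r a b) (ha : a ∈ S) (hb : b ∉ S) :
    ∃ j ∈ S, ∃ i ∉ S, r j i := by
  induction h with
  | refl => exact absurd ha hb
  | @tail c d _ hcd ih =>
    by_cases hc : c ∈ S
    · exact ⟨c, hc, d, hb, hcd⟩
    · exact ih hc

theorem IsTrap.reflTransGen_mem (h : P.IsTrap V) {a b : ℕ} (ha : a ∈ V)
    (hab : Relation.ReflTransGen P.arcs.Adj a b) : b ∈ V := by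
  induction hab with
  | refl => exact ha
  | tail _ hcd ih => exact h.closed _ ih _ hcd

theorem IsLeafSCC.reflTransGen (h : P.IsLeafSCC V) {a b : ℕ} (ha : a ∈ V) (hb : b ∈ V) :
    Relation.ReflTransGen P.arcs.Adj a b :=
  Relation.ReflTransGen.mono (fun _ _ hab => hab.1) _ _ (h.1.prop.2 a ha b hb)

theorem IsLeafSCC.nonempty (h : P.IsLeafSCC V) : V.Nonempty :=
  Finset.card_pos.1 (by have := h.2.1; omega)

theorem IsLeafSCC.isTrap (h : P.IsLeafSCC V) : P.IsTrap V where
  not_isLeaf v hv hl := by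
    obtain ⟨w, hw, hne⟩ := Finset.exists_mem_ne (by have := h.2.1; omega : 1 < V.card) v
    rcases (h.reflTransGen hv hw).cases_head with e | ⟨c, hc, -⟩
    · exact hne e.symm
    · exact hl c hc
  closed := h.2.2

/-- From a common vertex all of each SCC is reachable, while no path leaves the other. -/
theorem IsLeafSCC.disjoint (hV : P.IsLeafSCC V) (hW : P.IsLeafSCC W) (hne : V ≠ W) :
    Disjoint V W := by
  rw [Finset.disjoint_left]
  intro x hxV hxW
  refine hne (Finset.Subset.antisymm (fun y hy => ?_) fun y hy => ?_)
  · exact hW.isTrap.reflTransGen_mem hxW (hV.reflTransGen hxV hy)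
  · exact hV.isTrap.reflTransGen_mem hxV (hW.reflTransGen hxW hy)

theorem IsLeafSCC.exists_adj (h : P.IsLeafSCC V) {S : Set ℕ} {a b : ℕ}
    (ha : a ∈ V) (haS : a ∈ S) (hb : b ∈ V) (hbS : b ∉ S) :
    ∃ j ∈ V, j ∈ S ∧ ∃ i ∈ V, i ∉ S ∧ P.arcs.Adj j i := by
  obtain ⟨j, hj, i, hi, hji⟩ := exists_adj_of_reflTransGen (h.1.prop.2 a ha b hb) haS hbS
  exact ⟨j, hji.2.1, hj, i, hji.2.2, hi, hji.1⟩

theorem finite_isLeafSCC (P : GraphPair) {p : Finset ℕ → Prop} (h : ∀ V, p V → P.IsLeafSCC V) :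
    {V : Finset ℕ | p V}.Finite :=
  (Finset.range P.order).powerset.finite_toSet.subset fun V hV =>
    Finset.mem_coe.2 (Finset.mem_powerset.2 (h V hV).1.prop.1)

theorem exists_enumerates (P : GraphPair) {p : Finset ℕ → Prop} (h : ∀ V, p V → P.IsLeafSCC V) :
    ∃ L, Enumerates L p :=
  ⟨(P.finite_isLeafSCC h).toFinset.toList, Finset.nodup_toList _, fun V => by simp⟩

/-- A pair without leaf SCCs is grounded. -/
theorem isGrounded_of_forall_not_isLeafSCC (hP : P.IsSimple) (h : ¬ ∃ V, P.IsLeafSCC V) :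
    P.IsGrounded := by
  classical
  intro v hv
  have hlt : ∀ {a b}, a < P.order → Relation.ReflTransGen P.arcs.Adj a b → b < P.order := by
    intro a b ha hab
    rcases hab.cases_tail with rfl | ⟨c, -, hc⟩
    · exact ha
    · exact (hP.bounded _ _ hc).2
  by_cases hleaf : ∃ w, P.IsLeaf w ∧ Relation.ReflTransGen P.arcs.Adj v w
  · obtain ⟨w, hw, hvw⟩ := hleaf
    rcases Relation.reflTransGen_iff_eq_or_transGen.1 hvw with rfl | hvw'
    · exact Or.inl hw
    · exact Or.inr ⟨w, hlt hv hvw, hw, hvw'⟩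
  · refine absurd ?_ h
    let R : ℕ → Finset ℕ := fun z =>
      (Finset.range P.order).filter fun y => Relation.ReflTransGen P.arcs.Adj z y
    have hR : ∀ {z y}, z < P.order → (y ∈ R z ↔ Relation.ReflTransGen P.arcs.Adj z y) := by
      intro z y hz
      simp only [R, Finset.mem_filter, Finset.mem_range, and_iff_right_iff_imp]
      exact hlt hz
    -- A vertex `z` reachable from `v` with the smallest reachable set: any `y` in `R z` has `R y ⊆
    -- R z`, hence equality, so `y` reaches `z` back and `R z` is a leaf SCC.
    obtain ⟨z, hz, hmin⟩ := Finset.exists_min_image (R v) (fun z => (R z).card)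
      ⟨v, (hR hv).2 .refl⟩
    have hvz := (hR hv).1 hz
    have hz' := hlt hv hvz
    have hback : ∀ y ∈ R z, Relation.ReflTransGen P.arcs.Adj y z := by
      intro y hy
      have hzy := (hR hz').1 hy
      have hy' := hlt hz' hzy
      have hsub : R y ⊆ R z := fun w hw => (hR hz').2 (hzy.trans ((hR hy').1 hw))
      have heq := Finset.eq_of_subset_of_card_le hsub
        (hmin y ((hR hv).2 (hvz.trans hzy)))
      exact (hR hy').1 (heq ▸ (hR hz').2 .refl)
    have hclosed : ∀ i ∈ R z, ∀ j, P.arcs.Adj i j → j ∈ R z := fun i hi j hij =>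
      (hR hz').2 (((hR hz').1 hi).tail hij)
    refine ⟨R z, ⟨⟨Finset.filter_subset _ _, fun i hi j hj => ?_⟩, fun W hW hVW w hw => ?_⟩, ?_,
      hclosed⟩
    · have hij := (hback i hi).trans ((hR hz').1 hj)
      clear hj
      -- Membership is carried through the induction, so that the path is seen to stay inside `R z`.
      suffices j ∈ R z ∧ Relation.ReflTransGen (fun a b => P.arcs.Adj a b ∧ a ∈ R z ∧ b ∈ R z) i j
        from this.2
      induction hij with
      | refl => exact ⟨hi, .refl⟩
      | tail _ hab ih =>
        have hb := hclosed _ ih.1 _ hab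
        exact ⟨hb, ih.2.tail ⟨hab, ih.1, hb⟩⟩
    · exact (hR hz').2 (Relation.ReflTransGen.mono (fun _ _ hab => hab.1) _ _
        (hW.2 z (hVW ((hR hz').2 .refl)) w hw))
    · have hzl : ¬ P.IsLeaf z := fun hl => hleaf ⟨z, hl, hvz⟩
      obtain ⟨y, hy⟩ := not_forall_not.1 hzl
      refine Finset.one_lt_card.2 ⟨z, (hR hz').2 .refl, y, (hR hz').2 (.single hy), ?_⟩
      rintro rfl
      exact hP.loopless _ hy

theorem IsLeafSCC.trichotomy (h : P.IsLeafSCC V) :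
    P.IsMessageConnected V ∨ P.IsMessageDisconnected V ∨ P.IsDegenerated V ∨
      P.IsNonDegenerated V := by
  unfold IsNonDegenerated IsSemi
  tauto

/-- With `B` empty, `A` would have no neighbors, so no path of edges could leave it and `V` would be
message-disconnected. Hence appending always has a head for its arc. -/
theorem IsWitness.nonempty (h : P.IsWitness V A B) (hV : P.IsSemi V) : B.Nonempty := by
  rw [Finset.nonempty_iff_ne_empty]
  rintro rfl
  obtain ⟨a, ha⟩ := h.inside_nonempty
  obtain ⟨b, hb, hbA⟩ := Finset.exists_of_ssubset h.inside
  refine hV.2.2 ⟨hV.1, a, h.inside.1 ha, b, hb, fun hab => ?_⟩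
  obtain ⟨j, hj, i, hi, hji⟩ := exists_adj_of_reflTransGen (S := (A : Set ℕ))
    ((SimpleGraph.reachable_iff_reflTransGen a b).1 hab) ha hbA
  rcases h.neighbors i ⟨hi, j, hj, hji.symm⟩ with hw | ⟨b, hb, -⟩
  · simp at hw
  · simp at hb

theorem IsDegenerated.exists_appends (h : P.IsDegenerated V) : ∃ Q, P.AppendsDegenerated V Q := by
  obtain ⟨hs, A, B, hw⟩ := h
  obtain ⟨a, ha⟩ := hw.inside_nonempty
  by_cases hB : ∀ b ∈ B, P.IsLeaf b
  · obtain ⟨b, hb⟩ := hw.nonempty hs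
    exact ⟨_, A, B, hw, a, ha, b, hb, Or.inr hB, rfl⟩
  · push Not at hB
    obtain ⟨b, hb, hbl⟩ := hB
    exact ⟨_, A, B, hw, a, ha, b, hb, Or.inl hbl, rfl⟩

/-! ### The effect of the operations on leaf vertices -/

theorem isLeaf_addArc {u w : ℕ} (hu : ¬ P.IsLeaf u) (v : ℕ) :
    (P.addArc u w).IsLeaf v ↔ P.IsLeaf v := by
  refine ⟨fun h x hx => h x (Or.inl hx), fun h x hx => ?_⟩
  rcases hx with hx | ⟨rfl, -⟩
  exacts [h x hx, hu h]

theorem isLeaf_addDummy {u : ℕ} (hu : ¬ P.IsLeaf u) (v : ℕ) :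
    (P.addDummy u).IsLeaf v ↔ P.IsLeaf v := by
  refine ⟨fun h x hx => h x (Or.inl hx), fun h x hx => ?_⟩
  rcases hx with hx | ⟨rfl, -⟩
  exacts [h x hx, hu h]

theorem isLeaf_prune {u : ℕ} (v : ℕ) : (P.prune u).IsLeaf v ↔ P.IsLeaf v ∨ v = u := by
  constructor
  · intro h
    by_cases hv : v = u
    · exact Or.inr hv
    · exact Or.inl fun x hx => h x ⟨hx, hv⟩
  · rintro (h | rfl) x hx
    exacts [h x hx.1, hx.2 rfl]

/-- The index of the next dummy already counts as a leaf, so adding the dummy does not change the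
set of leaves. -/
theorem IsSimple.isLeaf_order (hP : P.IsSimple) : P.IsLeaf P.order := fun _ h =>
  lt_irrefl _ (hP.bounded _ _ h).1

theorem vOut_addArc {u w : ℕ} (hu : ¬ P.IsLeaf u) : (P.addArc u w).vOut = P.vOut := by
  simp only [vOut, isLeaf_addArc hu]
  rfl

theorem vOut_addDummy (hP : P.IsSimple) {u : ℕ} (hu : ¬ P.IsLeaf u) :
    (P.addDummy u).vOut = P.vOut := by
  simp only [vOut, isLeaf_addDummy hu]
  congr 1
  ext v
  refine ⟨fun h => ⟨lt_of_le_of_ne (Nat.lt_succ_iff.1 h.1) ?_, h.2⟩,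
    fun h => ⟨Nat.lt_succ_of_lt h.1, h.2⟩⟩
  rintro rfl
  exact h.2 hP.isLeaf_order

theorem finite_not_isLeaf (P : GraphPair) : {v : ℕ | v < P.order ∧ ¬ P.IsLeaf v}.Finite :=
  (Set.finite_lt_nat P.order).subset fun _ h => h.1

theorem vOut_prune (hP : P.IsSimple) {u : ℕ} (hu : ¬ P.IsLeaf u) :
    (P.prune u).vOut + 1 = P.vOut := by
  obtain ⟨w, hw⟩ := not_forall_not.1 hu
  have hmem : u ∈ {v : ℕ | v < P.order ∧ ¬ P.IsLeaf v} := ⟨(hP.bounded _ _ hw).1, hu⟩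
  rw [vOut, vOut, ← Set.ncard_sdiff_singleton_add_one hmem P.finite_not_isLeaf]
  congr 2
  ext v
  simp only [isLeaf_prune, Set.mem_ofPred_eq, Set.mem_sdiff, Set.mem_singleton_iff, not_or]
  exact and_assoc.symm

/-! ### Simplicity and traps -/

theorem IsSimple.prune (hP : P.IsSimple) (u : ℕ) : (P.prune u).IsSimple :=
  ⟨fun a b h => hP.bounded a b h.1, fun a h => hP.loopless a h.1⟩

theorem IsSimple.addArc (hP : P.IsSimple) {u w : ℕ} (hu : u < P.order) (hw : w < P.order)
    (hne : u ≠ w) : (P.addArc u w).IsSimple where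
  bounded := by
    rintro a b (h | ⟨rfl, rfl⟩)
    exacts [hP.bounded a b h, ⟨hu, hw⟩]
  loopless := by
    rintro a (h | ⟨rfl, rfl⟩)
    exacts [hP.loopless a h, hne rfl]

theorem IsSimple.lt_order (hP : P.IsSimple) {u : ℕ} (hu : ¬ P.IsLeaf u) : u < P.order := by
  obtain ⟨w, hw⟩ := not_forall_not.1 hu
  exact (hP.bounded _ _ hw).1

theorem IsSimple.addDummy (hP : P.IsSimple) {u : ℕ} (hu : ¬ P.IsLeaf u) :
    (P.addDummy u).IsSimple where
  bounded := by
    rintro a b (h | ⟨rfl, rfl⟩)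
    · exact ⟨Nat.lt_succ_of_lt (hP.bounded a b h).1, Nat.lt_succ_of_lt (hP.bounded a b h).2⟩
    · exact ⟨Nat.lt_succ_of_lt (hP.lt_order hu), Nat.lt_succ_self _⟩
  loopless := by
    rintro a (h | ⟨rfl, rfl⟩)
    exacts [hP.loopless a h, hu hP.isLeaf_order]

/-- Being a trap concerns only arcs with tail in `V`, untouched by changes at a vertex outside. The
`foreach` loops therefore track traps and not leaf SCCs, whose maximality involves other arcs. -/
theorem IsTrap.prune (hV : P.IsTrap V) {u : ℕ} (hu : u ∉ V) : (P.prune u).IsTrap V where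
  not_isLeaf v hv := by
    rw [isLeaf_prune, not_or]
    exact ⟨hV.not_isLeaf v hv, fun h => hu (h ▸ hv)⟩
  closed v hv w h := hV.closed v hv w h.1

theorem IsTrap.addDummy (hV : P.IsTrap V) {u : ℕ} (hu : ¬ P.IsLeaf u) (huV : u ∉ V) :
    (P.addDummy u).IsTrap V where
  not_isLeaf v hv := by
    rw [isLeaf_addDummy hu]
    exact hV.not_isLeaf v hv
  closed := by
    rintro v hv w (h | ⟨rfl, -⟩)
    exacts [hV.closed v hv w h, absurd hv huV]

/-! ### Decreasing quantities -/

/-- The number of vertices from which no leaf vertex can be reached. -/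
noncomputable def numUngrounded (P : GraphPair) : ℕ :=
  {v : ℕ | v < P.order ∧ ∀ w, P.IsLeaf w → ¬ Relation.ReflTransGen P.arcs.Adj v w}.ncard

/-- The number of ordered pairs of vertices that are not joined by a directed path. -/
noncomputable def numUnreachable (P : GraphPair) : ℕ :=
  {e : ℕ × ℕ | (e.1 < P.order ∧ e.2 < P.order) ∧
    ¬ Relation.ReflTransGen P.arcs.Adj e.1 e.2}.ncard

theorem reflTransGen_addArc {u w a b : ℕ} (h : Relation.ReflTransGen P.arcs.Adj a b) :
    Relation.ReflTransGen (P.addArc u w).arcs.Adj a b :=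
  Relation.ReflTransGen.mono (fun _ _ => Or.inl) _ _ h

theorem reflTransGen_addDummy {u a b : ℕ} (h : Relation.ReflTransGen P.arcs.Adj a b) :
    Relation.ReflTransGen (P.addDummy u).arcs.Adj a b :=
  Relation.ReflTransGen.mono (fun _ _ => Or.inl) _ _ h

theorem numUngrounded_addArc_le {u w : ℕ} (hu : ¬ P.IsLeaf u) :
    (P.addArc u w).numUngrounded ≤ P.numUngrounded := by
  refine Set.ncard_le_ncard ?_ ((Set.finite_lt_nat P.order).subset fun _ h => h.1)
  exact fun v h => ⟨h.1, fun x hx hvx => h.2 x ((isLeaf_addArc hu x).2 hx)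
    (reflTransGen_addArc hvx)⟩

/-- A trap contains no leaf and cannot be left, so `u` reached no leaf before; now it reaches the
dummy, which is itself a leaf and hence not counted. -/
theorem numUngrounded_addDummy_lt (hP : P.IsSimple) (hV : P.IsTrap V) {u : ℕ} (hu : u ∈ V) :
    (P.addDummy u).numUngrounded < P.numUngrounded := by
  have hul := hV.not_isLeaf u hu
  have hdummy : (P.addDummy u).IsLeaf P.order := (isLeaf_addDummy hul _).2 hP.isLeaf_order
  refine Set.ncard_lt_ncard ⟨?_, fun h => ?_⟩
    ((Set.finite_lt_nat P.order).subset fun _ h => h.1)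
  · intro v h
    refine ⟨lt_of_le_of_ne (Nat.lt_succ_iff.1 h.1) ?_, fun x hx hvx =>
      h.2 x ((isLeaf_addDummy hul x).2 hx) (reflTransGen_addDummy hvx)⟩
    rintro rfl
    exact h.2 _ hdummy .refl
  · have := h (a := u) ⟨hP.lt_order hul, fun w hw huw =>
      hV.not_isLeaf w (hV.reflTransGen_mem hu huw) hw⟩
    exact this.2 _ hdummy (.single (Or.inr ⟨rfl, rfl⟩))

theorem numUnreachable_addArc_lt {u w : ℕ} (hu : u < P.order) (hw : w < P.order)
    (h : ¬ Relation.ReflTransGen P.arcs.Adj u w) :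
    (P.addArc u w).numUnreachable < P.numUnreachable := by
  refine Set.ncard_lt_ncard ⟨fun e he => ⟨he.1, fun h' => he.2 (reflTransGen_addArc h')⟩,
    fun hsub => ?_⟩
    (((Set.finite_lt_nat P.order).prod (Set.finite_lt_nat P.order)).subset fun _ h => h.1)
  exact (hsub (a := (u, w)) ⟨⟨hu, hw⟩, h⟩).2 (.single (Or.inr ⟨rfl, rfl⟩))

end GraphPair

/-! ### Decodability of arcs and its preservation -/

namespace GraphPair

variable {n s : ℕ} {G : Digraph (Fin n)} {M : Fin s → Finset (Fin n)} {P : GraphPair}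
  {V W A B : Finset ℕ}

/-- Every index code determines the tail of each arc from the head of the arc and the leaf
vertices. -/
def IsDecodable (G : Digraph (Fin n)) (M : Fin s → Finset (Fin n)) (P : GraphPair) : Prop :=
  ∀ (c : IndexCode (singleUniprior G M)) (a b : ℕ), P.arcs.Adj a b →
    c.Determines (insert b {v | P.IsLeaf v}) a

theorem IsDecodable.of_reflTransGen (hP : P.IsDecodable G M)
    (c : IndexCode (singleUniprior G M)) {S : Set ℕ} (hS : ∀ v, P.IsLeaf v → c.Determines S v)
    {a b : ℕ} (hab : Relation.ReflTransGen P.arcs.Adj a b) (hb : c.Determines S b) :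
    c.Determines S a := by
  induction hab using Relation.ReflTransGen.head_induction_on with
  | refl => exact hb
  | head hac _ ih =>
    refine (hP c _ _ hac).trans ?_
    rintro v (rfl | hv)
    exacts [ih, hS v hv]

theorem adj_map_messageGraph {t : Fin s} {a b : Fin n} (ha : a ∈ M t) (hb : b ∈ M t)
    (hne : (a : ℕ) ≠ b) : ((messageGraph M).map Fin.valEmbedding).Adj a b :=
  (SimpleGraph.map_adj_apply (f := Fin.valEmbedding) (G := messageGraph M)).2
    ⟨fun h => hne (h ▸ rfl), t, ha, hb⟩

/-- Strong connectivity gives an arc j → i of `V` leaving `A`. As i is neither in `A` nor a neighbor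
of it, x_i is replaceable by the neighbors of `A`; every vertex of `V` reaches j, so x_j yields the
rest. The set `A` need not lie in `V`. -/
theorem IsDecodable.of_crossing (hP : P.IsDecodable G M)
    (hE : P.edges = (messageGraph M).map Fin.valEmbedding)
    (c : IndexCode (singleUniprior G M)) (hV : P.IsLeafSCC V) {A : Set ℕ} {a b : ℕ}
    (ha : a ∈ V) (haA : a ∈ A) (hb : b ∈ V) (hbA : b ∉ A)
    (hA : ∀ i ∈ A, ∀ j ∈ V, j ∉ A → ¬ P.edges.Adj i j) {S : Set ℕ}
    (hS : ∀ v, P.IsLeaf v → c.Determines S v)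
    (hN : ∀ w, w ∉ A → (∃ v ∈ A, P.edges.Adj w v) → c.Determines S w)
    {v : ℕ} (hv : v ∈ V) : c.Determines S v := by
  obtain ⟨j, hj, hjA, i, hi, hiA, hji⟩ := hV.exists_adj ha haA hb hbA
  refine hP.of_reflTransGen c hS (hV.reflTransGen hv hj) ?_
  have key := (hP c j i hji).of_separated (A := A) (N := {w | w ∉ A ∧ ∃ v ∈ A, P.edges.Adj w v})
    ?_ hjA ?_
  · refine key.trans ?_
    rintro w (hw | hw)
    exacts [hS w hw, hN w hw.1 hw.2]
  · intro t x hx y hy hxA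
    by_cases hyA : (y : ℕ) ∈ A
    · exact Or.inl hyA
    · refine Or.inr ⟨hyA, x, hxA, ?_⟩
      rw [hE]
      exact adj_map_messageGraph hy hx fun h => hyA (h ▸ hxA)
  · rintro (h | ⟨-, v, hv, h⟩)
    exacts [hiA h, hA v hv i hi hiA h.symm]

theorem IsMessageDisconnected.determines (hV : P.IsMessageDisconnected V)
    (hP : P.IsDecodable G M) (hE : P.edges = (messageGraph M).map Fin.valEmbedding)
    (c : IndexCode (singleUniprior G M)) {v : ℕ} (hv : v ∈ V) :
    c.Determines {v | P.IsLeaf v} v := by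
  obtain ⟨hV, a, ha, b, hb, hab⟩ := hV
  -- A whole component of the message graph has no neighbors.
  refine hP.of_crossing hE c hV (A := {v | P.edges.Reachable a v}) ha (.refl a) hb hab ?_
    (fun v hv => .of_mem hv) ?_ hv
  · exact fun i hi j _ hj hij => hj (hi.trans hij.reachable)
  · rintro w hw ⟨v, hv, hwv⟩
    exact absurd (hv.trans hwv.symm.reachable) hw

theorem IsWitness.determines (hw : P.IsWitness V A B) (hV : P.IsLeafSCC V)
    (hP : P.IsDecodable G M) (hE : P.edges = (messageGraph M).map Fin.valEmbedding)
    (c : IndexCode (singleUniprior G M)) {w : ℕ} (hwB : w ∈ B)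
    (hleaf : ¬ P.IsLeaf w ∨ ∀ b ∈ B, P.IsLeaf b) {v : ℕ} (hv : v ∈ V) :
    c.Determines (insert w {v | P.IsLeaf v}) v := by
  obtain ⟨a, ha⟩ := hw.inside_nonempty
  obtain ⟨b, hb, hbA⟩ := Finset.exists_of_ssubset hw.inside
  have hS : ∀ v, P.IsLeaf v → c.Determines (insert w {v | P.IsLeaf v}) v :=
    fun v hv => .of_mem (Or.inr hv)
  -- A non-leaf `b` in `B` must be `w`: such a `b` rules out that `B` consists of leaves, so `w` is
  -- non-leaf, and `B` has at most one such vertex.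
  have hB : ∀ b ∈ B, c.Determines (insert w {v | P.IsLeaf v}) b := by
    intro b hb
    by_cases hbl : P.IsLeaf b
    · exact hS b hbl
    · rcases hleaf with h | h
      · exact .of_mem (Or.inl (hw.nonleaf_unique b hb w hwB hbl h))
      · exact absurd (h b hb) hbl
  refine hP.of_crossing hE c hV (A := (A : Set ℕ)) (hw.inside.1 ha) ha hb hbA ?_ hS ?_ hv
  · exact fun i hi j hj hjA => hw.no_edge i hi j (Finset.mem_sdiff.2 ⟨hj, hjA⟩)
  · intro x hx hxA
    rcases hw.neighbors x ⟨hx, hxA⟩ with h | ⟨b, hb, hxb⟩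
    · exact hB x h
    · exact hP.of_reflTransGen c hS hxb.to_reflTransGen (hB b hb)

theorem IsDecodable.prune (hP : P.IsDecodable G M) (u : ℕ) : (P.prune u).IsDecodable G M :=
  fun c a b h => (hP c a b h.1).mono
    (Set.insert_subset_insert fun v hv => (isLeaf_prune v).2 (Or.inl hv))

theorem IsDecodable.addArc (hP : P.IsDecodable G M) {u w : ℕ} (hu : ¬ P.IsLeaf u)
    (h : ∀ c : IndexCode (singleUniprior G M), c.Determines (insert w {v | P.IsLeaf v}) u) :
    (P.addArc u w).IsDecodable G M := by
  intro c a b hab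
  simp only [isLeaf_addArc hu]
  rcases hab with hab | ⟨rfl, rfl⟩
  exacts [hP c a b hab, h c]

theorem IsDecodable.addDummy (hP : P.IsDecodable G M) {u : ℕ} (hu : ¬ P.IsLeaf u)
    (h : ∀ c : IndexCode (singleUniprior G M), c.Determines {v | P.IsLeaf v} u) :
    (P.addDummy u).IsDecodable G M := by
  intro c a b hab
  simp only [isLeaf_addDummy hu]
  rcases hab with hab | ⟨rfl, rfl⟩
  exacts [hP c a b hab, (h c).mono (Set.subset_insert _ _)]

theorem IsGrounded.vOut_le (h : P.IsGrounded) (hP : P.IsDecodable G M)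
    (hM : ∀ i, ∃ t, i ∈ M t) : P.vOut ≤ (singleUniprior G M).optimalCodelength := by
  refine IndexCodingInstance.le_optimalCodelength
    (IndexCodingInstance.nonempty_indexCode _ hM) fun c =>
    c.ncard_le_codelength P.finite_not_isLeaf fun v hv => ?_
  have hS : ∀ v, P.IsLeaf v → c.Determines {v : ℕ | v < P.order ∧ ¬ P.IsLeaf v}ᶜ v :=
    fun v hv => .of_mem fun h => h.2 hv
  rcases h v hv.1 with hl | ⟨w, -, hw, hvw⟩
  · exact hS v hl
  · exact hP.of_reflTransGen c hS hvw.to_reflTransGen (hS w hw)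

end GraphPair

/-! ### The invariant of the algorithm -/

open GraphPair

/-- The lists of disjoint leaf SCCs that the `foreach` loops work through. -/
def IsTrapList (P : GraphPair) (L : List (Finset ℕ)) : Prop :=
  L.Pairwise Disjoint ∧ ∀ V ∈ L, P.IsTrap V

theorem Enumerates.isTrapList {P : GraphPair} {L : List (Finset ℕ)} {p : Finset ℕ → Prop}
    (h : Enumerates L p) (hp : ∀ V, p V → P.IsLeafSCC V) : IsTrapList P L :=
  ⟨h.1.pairwise_of_forall_ne fun V hV W hW hne =>
    (hp V ((h.2 V).1 hV)).disjoint (hp W ((h.2 W).1 hW)) hne,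
   fun V hV => (hp V ((h.2 V).1 hV)).isTrap⟩

theorem Enumerates.length_eq {L : List (Finset ℕ)} {p : Finset ℕ → Prop}
    (h : Enumerates L p) : L.length = {V | p V}.ncard := by
  classical
  rw [← List.toFinset_card_of_nodup h.1, ← Set.ncard_coe_finset]
  congr 1
  ext V
  simpa using h.2 V

theorem IsTrapList.prune {P : GraphPair} {V : Finset ℕ} {L : List (Finset ℕ)}
    (h : IsTrapList P (V :: L)) {v : ℕ} (hv : v ∈ V) : IsTrapList (P.prune v) L := by
  obtain ⟨hd, ht⟩ := h
  rw [List.pairwise_cons] at hd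
  exact ⟨hd.2, fun W hW => (ht W (List.mem_cons_of_mem _ hW)).prune
    (Finset.disjoint_left.1 (hd.1 W hW) hv)⟩

theorem IsTrapList.addDummy {P : GraphPair} {V : Finset ℕ} {L : List (Finset ℕ)}
    (h : IsTrapList P (V :: L)) {v : ℕ} (hv : v ∈ V) : IsTrapList (P.addDummy v) L := by
  obtain ⟨hd, ht⟩ := h
  rw [List.pairwise_cons] at hd
  exact ⟨hd.2, fun W hW => (ht W (List.mem_cons_of_mem _ hW)).addDummy
    ((ht V List.mem_cons_self).not_isLeaf v hv) (Finset.disjoint_left.1 (hd.1 W hW) hv)⟩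

/-- What holds at each point of control, `N` being the number of pruning steps that Initialization
makes in total. -/
def ControlInvariant {n s : ℕ} (G : Digraph (Fin n)) (M : Fin s → Finset (Fin n))
    (P₀ P : GraphPair) (p : ℕ) : Control → Prop
  | .start => P = P₀ ∧ p = 0
  | .initPrune L => IsTrapList P L ∧ (∀ V ∈ L, V.Nonempty) ∧
      p + L.length = P₀.numMessageConnected
  | .appendDisc L => IsTrapList P L ∧ (∀ V ∈ L, V.Nonempty) ∧
      (∀ c : IndexCode (singleUniprior G M), ∀ V ∈ L, ∀ v ∈ V,
        c.Determines {v | P.IsLeaf v} v) ∧ p = P₀.numMessageConnected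
  | .iterTest => (¬ ∃ V, P.IsMessageDisconnected V ∨ P.IsDegenerated V) ∧
      p = P₀.numMessageConnected
  | .done => (¬ ∃ V, P.IsLeafSCC V) ∧ p = P₀.numMessageConnected
  | .cleanTest | .appendDeg => p = P₀.numMessageConnected

/-- The invariant of the algorithm on the input `P₀`. -/
structure Invariant {n s : ℕ} (G : Digraph (Fin n)) (M : Fin s → Finset (Fin n))
    (P₀ : GraphPair) (c : Config) : Prop where
  edges_eq : c.graphs.edges = (messageGraph M).map Fin.valEmbedding
  isSimple : c.graphs.IsSimple
  isDecodable : c.graphs.IsDecodable G M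
  vOut_eq : c.graphs.vOut + c.initPrunes + c.iterPrunes = P₀.vOut
  iterations_eq : c.iterations = c.iterPrunes
  control : ControlInvariant G M P₀ c.graphs c.initPrunes c.control

variable {n s : ℕ} {G : Digraph (Fin n)} {M : Fin s → Finset (Fin n)} {P₀ : GraphPair}

theorem Invariant.initial (hG : ∀ i, ¬ G.Adj i i) :
    Invariant G M (.ofGraphs G (messageGraph M))
      (.initial (.ofGraphs G (messageGraph M))) where
  edges_eq := rfl
  isSimple := by
    constructor
    · rintro a b ⟨i, j, -, rfl, rfl⟩
      exact ⟨i.2, j.2⟩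
    · rintro a ⟨i, j, h, hi, hj⟩
      obtain rfl : i = j := Fin.ext (hi.trans hj.symm)
      exact hG i h
  isDecodable := by
    rintro c a b ⟨i, j, h, rfl, rfl⟩
    exact (singleUniprior_determines c h).mono (by simp)
  vOut_eq := rfl
  iterations_eq := rfl
  control := ⟨rfl, rfl⟩

theorem Invariant.step {c c' : Config} (h : Invariant G M P₀ c) (hs : Step c c') :
    Invariant G M P₀ c' := by
  obtain ⟨hE, hP, hD, hv, hk, hc⟩ := h
  cases hs with
  | enter L hL =>
    obtain ⟨rfl, rfl⟩ := hc
    exact ⟨hE, hP, hD, hv, hk, hL.isTrapList fun V hV => hV.1,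
      fun V hV => ((hL.2 V).1 hV).1.nonempty, by rw [zero_add]; exact hL.length_eq⟩
  | initPrune hQ =>
    obtain ⟨v, hvV, rfl⟩ := hQ
    obtain ⟨hL, hne, hlen⟩ := hc
    have := vOut_prune hP ((hL.2 _ List.mem_cons_self).not_isLeaf v hvV)
    refine ⟨hE, hP.prune v, hD.prune v, ?_, hk, hL.prune hvV,
      fun V hV => hne V (List.mem_cons_of_mem _ hV), ?_⟩
    · dsimp only at this hv ⊢; omega
    · dsimp only at hlen ⊢; rw [← hlen, List.length_cons]; omega
  | initPruneEnd => exact ⟨hE, hP, hD, hv, hk, hc.2.2⟩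
  | cleanEnter L _ hL =>
    exact ⟨hE, hP, hD, hv, hk, hL.isTrapList fun V hV => hV.1,
      fun V hV => ((hL.2 V).1 hV).1.nonempty,
      fun c V hV v hvV => ((hL.2 V).1 hV).determines hD hE c hvV, hc⟩
  | cleanExit h => exact ⟨hE, hP, hD, hv, hk, h, hc⟩
  | appendDisc hQ =>
    obtain ⟨v, hvV, rfl⟩ := hQ
    obtain ⟨hL, hne, hdet, hp⟩ := hc
    have hl := (hL.2 _ List.mem_cons_self).not_isLeaf v hvV
    refine ⟨hE, hP.addDummy hl, hD.addDummy hl fun c => hdet c _ List.mem_cons_self v hvV,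
      ?_, hk, hL.addDummy hvV, fun V hV => hne V (List.mem_cons_of_mem _ hV), ?_, hp⟩
    · rw [← hv]; exact congrArg (· + _ + _) (vOut_addDummy hP hl)
    -- Determination by the leaves was established on entering the loop and persists because the set
    -- of leaves does not change; the remaining sets need not be shown message-disconnected again.
    · intro c V hV w hw
      simp only [isLeaf_addDummy hl]
      exact hdet c V (List.mem_cons_of_mem _ hV) w hw
  | appendDiscEnd => exact ⟨hE, hP, hD, hv, hk, hc.2.2.2⟩
  | appendDeg V hV hQ =>
    obtain ⟨A, B, hw, u, hu, w, hwB, hwl, rfl⟩ := hQ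
    have huV := hw.inside.1 hu
    have hl := hV.1.1.isTrap.not_isLeaf u huV
    have hwB' := Finset.mem_sdiff.1 (hw.outside hwB)
    refine ⟨hE, hP.addArc (hP.lt_order hl) (Finset.mem_range.1 hwB'.1) ?_,
      hD.addArc hl fun c => hw.determines hV.1.1 hD hE c hwB hwl huV, ?_, hk, hc⟩
    · rintro rfl
      exact hwB'.2 huV
    · rw [← hv]; exact congrArg (· + _ + _) (vOut_addArc hl)
  | appendDegEnd h => exact ⟨hE, hP, hD, hv, hk, hc⟩
  | iterConnected V hV hQ =>
    obtain ⟨v, hvV, rfl⟩ := hQ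
    have := vOut_prune hP (hV.1.isTrap.not_isLeaf v hvV)
    refine ⟨hE, hP.prune v, hD.prune v, ?_, congrArg (· + 1) hk, hc.2⟩
    dsimp only at this hv ⊢; omega
  | iterNonDegenerated V _ hV hQ =>
    obtain ⟨v, hvV, rfl⟩ := hQ
    have := vOut_prune hP (hV.1.1.isTrap.not_isLeaf v hvV)
    refine ⟨hE, hP.prune v, hD.prune v, ?_, congrArg (· + 1) hk, hc.2⟩
    dsimp only at this hv ⊢; omega
  | iterExit h => exact ⟨hE, hP, hD, hv, hk, h, hc.2⟩

theorem Invariant.of_reaches (hG : ∀ i, ¬ G.Adj i i) {c : Config}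
    (h : Reaches (.ofGraphs G (messageGraph M)) c) :
    Invariant G M (.ofGraphs G (messageGraph M)) c := by
  induction h with
  | refl => exact .initial hG
  | tail _ hs ih => exact ih.step hs

/-- A run could only get stuck on an empty set in a `foreach` list, on a degenerated SCC without an
arc to add, or in `iterTest` with only message-disconnected or degenerated leaf SCCs. The invariant
excludes the first and the last, `exists_appends` the second. -/
theorem Invariant.exists_step {c : Config} (h : Invariant G M P₀ c) (hc : c.control ≠ .done) :
    ∃ c', Step c c' := by
  obtain ⟨ctrl, P, p, q, k⟩ := c
  obtain ⟨-, -, -, -, -, hI⟩ := h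
  cases ctrl with
  | start =>
    obtain ⟨L, hL⟩ := P.exists_enumerates (p := P.IsMessageConnected) fun _ h => h.1
    exact ⟨_, .enter L hL⟩
  | initPrune L =>
    cases L with
    | nil => exact ⟨_, .initPruneEnd⟩
    | cons V L =>
      obtain ⟨v, hv⟩ := hI.2.1 V List.mem_cons_self
      exact ⟨_, .initPrune ⟨v, hv, rfl⟩⟩
  | cleanTest =>
    by_cases h : ∃ V, P.IsMessageDisconnected V ∨ P.IsDegenerated V
    · obtain ⟨L, hL⟩ := P.exists_enumerates (p := P.IsMessageDisconnected) fun _ h => h.1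
      exact ⟨_, .cleanEnter L h hL⟩
    · exact ⟨_, .cleanExit h⟩
  | appendDisc L =>
    cases L with
    | nil => exact ⟨_, .appendDiscEnd⟩
    | cons V L =>
      obtain ⟨v, hv⟩ := hI.2.1 V List.mem_cons_self
      exact ⟨_, .appendDisc ⟨v, hv, rfl⟩⟩
  | appendDeg =>
    by_cases h : ∃ V, P.IsDegenerated V
    · obtain ⟨V, hV⟩ := h
      obtain ⟨Q, hQ⟩ := hV.exists_appends
      exact ⟨_, .appendDeg V hV hQ⟩
    · exact ⟨_, .appendDegEnd h⟩
  | iterTest =>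
    by_cases hconn : ∃ V, P.IsMessageConnected V
    · obtain ⟨V, hV⟩ := hconn
      obtain ⟨v, hv⟩ := hV.1.nonempty
      exact ⟨_, .iterConnected V hV ⟨v, hv, rfl⟩⟩
    by_cases hscc : ∃ V, P.IsLeafSCC V
    · obtain ⟨V, hV⟩ := hscc
      obtain ⟨v, hv⟩ := hV.nonempty
      rcases hV.trichotomy with h | h | h | h
      · exact absurd ⟨V, h⟩ hconn
      · exact absurd ⟨V, Or.inl h⟩ hI.1
      · exact absurd ⟨V, Or.inr h⟩ hI.1
      · exact ⟨_, .iterNonDegenerated V hconn h ⟨v, hv, rfl⟩⟩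
    · exact ⟨_, .iterExit hscc⟩
  | done => exact absurd rfl hc

/-! ### Termination -/

open Classical in
/-- A rank that decreases in the steps that do not change the graphs. The part of a cleaning round
in which an arc is still bound to be added ranks below the test that begins the round. -/
noncomputable def controlRank (P : GraphPair) : Control → ℕ
  | .start => 9
  | .initPrune _ => 8
  | .appendDisc [] => if ∃ V, P.IsDegenerated V then 2 else 7
  | .appendDeg => if ∃ V, P.IsDegenerated V then 1 else 6
  | .cleanTest => 5
  | .appendDisc (_ :: _) => 4
  | .iterTest => 4
  | .done => 3

/-- The termination measure of the algorithm. -/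
noncomputable def Config.rank (c : Config) : ℕ ×ₗ ℕ ×ₗ ℕ ×ₗ ℕ :=
  toLex (c.graphs.vOut, toLex (c.graphs.numUngrounded,
    toLex (c.graphs.numUnreachable, controlRank c.graphs c.control)))

theorem Config.rank_lt_iff {c c' : Config} : c'.rank < c.rank ↔
    c'.graphs.vOut < c.graphs.vOut ∨ c'.graphs.vOut = c.graphs.vOut ∧
      (c'.graphs.numUngrounded < c.graphs.numUngrounded ∨
        c'.graphs.numUngrounded = c.graphs.numUngrounded ∧
        (c'.graphs.numUnreachable < c.graphs.numUnreachable ∨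
          c'.graphs.numUnreachable = c.graphs.numUnreachable ∧
          controlRank c'.graphs c'.control < controlRank c.graphs c.control)) := by
  simp only [Config.rank, Prod.Lex.toLex_lt_toLex]

theorem Invariant.rank_lt {c c' : Config} (h : Invariant G M P₀ c) (hs : Step c c') :
    c'.rank < c.rank := by
  obtain ⟨-, hP, -, -, -, hc⟩ := h
  rw [Config.rank_lt_iff]
  cases hs with
  | enter L hL => simp [controlRank]
  | initPrune hQ =>
    obtain ⟨v, hvV, rfl⟩ := hQ
    have := vOut_prune hP ((hc.1.2 _ List.mem_cons_self).not_isLeaf v hvV)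
    exact Or.inl (by dsimp only at this ⊢; omega)
  | initPruneEnd => simp [controlRank]
  | @cleanEnter P p q k L hex hL =>
    cases L with
    | nil =>
      -- With nothing message-disconnected, the loop was entered because of a degenerated SCC, so
      -- this round cannot pass without adding an arc.
      have : ∃ V, P.IsDegenerated V := by
        obtain ⟨V, hV | hV⟩ := hex
        · simpa using (hL.2 V).2 hV
        · exact ⟨V, hV⟩
      simp [controlRank, this]
    | cons V L => simp [controlRank]
  | cleanExit h => simp [controlRank]
  | appendDisc hQ =>
    obtain ⟨v, hvV, rfl⟩ := hQ
    have ht := hc.1.2 _ List.mem_cons_self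
    exact Or.inr ⟨vOut_addDummy hP (ht.not_isLeaf v hvV),
      Or.inl (numUngrounded_addDummy_lt hP ht hvV)⟩
  | appendDiscEnd =>
    simp only [controlRank]
    split_ifs <;> simp
  | appendDeg V hV hQ =>
    obtain ⟨A, B, hw, u, hu, w, hwB, hwl, rfl⟩ := hQ
    have huV := hw.inside.1 hu
    have ht := hV.1.1.isTrap
    have hl := ht.not_isLeaf u huV
    have hwB' := Finset.mem_sdiff.1 (hw.outside hwB)
    refine Or.inr ⟨vOut_addArc hl, ?_⟩
    rcases (numUngrounded_addArc_le (w := w) hl).lt_or_eq with h | h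
    · exact Or.inl h
    -- The head `w` lies outside the trap `V`, so `u` did not reach it before.
    · exact Or.inr ⟨h, Or.inl (numUnreachable_addArc_lt (hP.lt_order hl)
        (Finset.mem_range.1 hwB'.1) fun huw => hwB'.2 (ht.reflTransGen_mem huV huw))⟩
  | appendDegEnd h => simp [controlRank, h]
  | iterConnected V hV hQ =>
    obtain ⟨v, hvV, rfl⟩ := hQ
    have := vOut_prune hP (hV.1.isTrap.not_isLeaf v hvV)
    exact Or.inl (by dsimp only at this ⊢; omega)
  | iterNonDegenerated V _ hV hQ =>
    obtain ⟨v, hvV, rfl⟩ := hQ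
    have := vOut_prune hP (hV.1.1.isTrap.not_isLeaf v hvV)
    exact Or.inl (by dsimp only at this ⊢; omega)
  | iterExit h => simp [controlRank]

theorem mainTheorem5 {n s : ℕ} (G : Digraph (Fin n)) (hG : ∀ i, ¬ G.Adj i i)
    (M : Fin s → Finset (Fin n)) (hM : ∀ i, ∃ t, i ∈ M t) :
    AlwaysTerminates (GraphPair.ofGraphs G (messageGraph M)) ∧
    ∀ c : Config, Reaches (GraphPair.ofGraphs G (messageGraph M)) c → c.control = .done →
      c.graphs.IsGrounded ∧
      c.graphs.vOut ≤ (singleUniprior G M).optimalCodelength ∧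
      (c.graphs.vOut : ℤ) = (GraphPair.ofGraphs G (messageGraph M)).vOut
        - c.initPrunes - c.iterPrunes ∧
      (c.graphs.vOut : ℤ) = (GraphPair.ofGraphs G (messageGraph M)).vOut
        - ((GraphPair.ofGraphs G (messageGraph M)).numMessageConnected + c.iterations) := by
  refine ⟨⟨?_, fun c hc => (Invariant.of_reaches hG hc).exists_step⟩, fun c hc hdone => ?_⟩
  · rintro ⟨f, hf0, hf⟩
    have hI : ∀ i, Invariant G M (.ofGraphs G (messageGraph M)) (f i) := by
      intro i
      induction i with
      | zero => exact hf0 ▸ .initial hG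
      | succ i ih => exact ih.step (hf i)
    exact (WellFounded.not_rel_apply_succ (r := (· < ·)) fun i => (f i).rank).elim
      fun i hi => hi ((hI i).rank_lt (hf i))
  · have hI := Invariant.of_reaches hG hc
    have hctrl := hI.control
    rw [hdone] at hctrl
    have hground := isGrounded_of_forall_not_isLeafSCC hI.isSimple hctrl.1
    have h1 := hI.vOut_eq
    have h2 := hctrl.2
    have h3 := hI.iterations_eq
    exact ⟨hground, hground.vOut_le hI.isDecodable hM, by omega, by omega⟩
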